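/- Let $K$ be a real symmetric positive definite $n\times n$ matrix. For $S,T\subseteq[1:n]=\{1,\dots,n\}$ let $K(S,T)$ be the submatrix of $K$ with rows indexed by $S$ and columns indexed by $T$, let $K(S)=K(S,S)$, let $|\cdot|$ denote the determinant (the determinant of the empty matrix is $1$), and let $S^{\mathrm c}=[1:n]\setminus S$. Let $k,p\in[1:n]$ with $k\le p$, and let $P=[1:p]$. Then $$|K|\;\le\;|K(P^{\mathrm c})|\Bigg(\prod_{S\subseteq P:\,|S|=k}\frac{|K(S\cup P^{\mathrm c})|}{|K(P^{\mathrm c})|}\Bigg)^{1/\binom{p-1}{k-1}}\;\le\;\Bigg(\prod_{S\subseteq[1:n]:\,|S|=k}|K(S)|\Bigg)^{1/\binom{n-1}{k-1}},$$ where the last expression is the bound on $|K|$ in Szász's inequality. Moreover: 1. If $k<p$, equality holds in the first inequality if and only if the Schur complement $K(P)-K(P,P^{\mathrm c})K(P^{\mathrm c})^{-1}K(P^{\mathrm c},P)$ of $K(P^{\mathrm c})$ in $K$ is diagonal. 2. If $k=1$ and $p<n$, equality holds in the second inequality if and only if $K(P,P^{\mathrm c})=0$ and $K(P^{\mathrm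 c})$ is diagonal. 3. If $2\le k\le p<n$, equality holds in the second inequality if and only if $K$ is diagonal. 4. If $p=n$, equality holds in the second inequality. 5. If $k=1$, the middle expression equals $|K(P^{\mathrm c})|\prod_{i=1}^{p}\frac{|K(\{i\}\cup P^{\mathrm c})|}{|K(P^{\mathrm c})|}$, so that the first inequality becomes Ky Fan's inequality. -/

import Mathlib

/-- `K(S, T)`: the submatrix of `K` with rows indexed by `S` and columns indexed by `T`. -/
def subMat {n : ℕ} (K : Matrix (Fin n) (Fin n) ℝ) (S T : Finset (Fin n)) : Matrix S T ℝ :=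
  K.submatrix (fun i : S => (i : Fin n)) (fun j : T => (j : Fin n))

/-- `|K(S)|`: the determinant of the principal submatrix `K(S) = K(S, S)`; it is `1` for `S = ∅`. -/
def minorDet {n : ℕ} (K : Matrix (Fin n) (Fin n) ℝ) (S : Finset (Fin n)) : ℝ :=
  (subMat K S S).det

/-- The set of the first `p` of the `n` indices, `P = [1 : p]` (indices are shifted to start at 0). -/
def firstIdx (n p : ℕ) : Finset (Fin n) :=
  Finset.univ.filter (fun i : Fin n => (i : ℕ) < p)

/-- The Schur complement `K(P) - K(P, Pᶜ) K(Pᶜ)⁻¹ K(Pᶜ, P)` of `K(Pᶜ)` in `K`. -/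
noncomputable def schurCompl {n : ℕ} (K : Matrix (Fin n) (Fin n) ℝ) (P : Finset (Fin n)) :
    Matrix P P ℝ :=
  subMat K P P - subMat K P Pᶜ * (subMat K Pᶜ Pᶜ)⁻¹ * subMat K Pᶜ P

/-- The conditional bound
`|K(Pᶜ)| (∏_{S ⊆ P, |S| = k} |K(S ∪ Pᶜ)| / |K(Pᶜ)|) ^ (1 / C(p - 1, k - 1))` with `P = [1 : p]`. -/
noncomputable def condSzaszBound {n : ℕ} (K : Matrix (Fin n) (Fin n) ℝ) (p k : ℕ) : ℝ :=
  minorDet K (firstIdx n p)ᶜ *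
    (∏ S ∈ (firstIdx n p).powersetCard k,
      minorDet K (S ∪ (firstIdx n p)ᶜ) / minorDet K (firstIdx n p)ᶜ) ^
        ((1 : ℝ) / ((p - 1).choose (k - 1) : ℝ))

/-- The bound in the classical inequality of Szász:
`(∏_{S ⊆ [1 : n], |S| = k} |K(S)|) ^ (1 / C(n - 1, k - 1))`. -/
noncomputable def szaszBound {n : ℕ} (K : Matrix (Fin n) (Fin n) ℝ) (k : ℕ) : ℝ :=
  (∏ S ∈ (Finset.univ : Finset (Fin n)).powersetCard k, minorDet K S) ^
    ((1 : ℝ) / ((n - 1).choose (k - 1) : ℝ))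

/-! Put `g S = log |K(S)|` and `C = Pᶜ`. The marginal `g (A ∪ {i}) - g A` is the logarithm of the
residual variance of variable `i` after regression on `A`. By Pythagoras this variance can only drop
when `A` grows, so `g` is submodular. Expand each `g` along an order by the chain rule. For the
first inequality, a set `S ⊆ P` conditions each `i` on fewer predecessors than `P` does. For the
second, let `C` precede `P`. On the right, `i ∈ P` is conditioned on its predecessors in a random
`m`-subset `T` of the other indices, where `m = k - 1`. On the left it is conditioned on `C` and its
predecessors in a random `m`-subset `T'` of `P \ {i}`. Coupling so that `T ∩ P ⊆ T'` makes the
comparison termwise (`average_powersetCard_le`). The bounds do not mention the order, so equality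
forces termwise equality in every admissible order. Positive definiteness turns equal marginals on
nested sets into equal residual vectors (`IsResidual.eq_of_eq`). Well-chosen orders then make the
supports so small that the required entries vanish. -/

/-! ### Averages over subsets of fixed size -/

open Finset in
/-- Choose `T'` uniformly among the `m`-subsets of `Q`, and `T` uniformly among the `m`-subsets of
`N ⊇ Q`. These can be coupled so that `T ∩ Q ⊆ T'`, hence averages compare if the values do. -/
theorem average_powersetCard_le {α : Type*} [DecidableEq α] {N Q : Finset α} (hQN : Q ⊆ N) {m : ℕ}
    (hm : m ≤ #Q) (φ ψ : Finset α → ℝ)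
    (h : ∀ T ∈ N.powersetCard m, ∀ T' ∈ Q.powersetCard m, T ∩ Q ⊆ T' → ψ T' ≤ φ T) :
    (1 / ((#Q).choose m : ℝ)) * ∑ T' ∈ Q.powersetCard m, ψ T' ≤
        (1 / ((#N).choose m : ℝ)) * ∑ T ∈ N.powersetCard m, φ T ∧
      ((1 / ((#Q).choose m : ℝ)) * ∑ T' ∈ Q.powersetCard m, ψ T' =
        (1 / ((#N).choose m : ℝ)) * ∑ T ∈ N.powersetCard m, φ T →
        ∀ T ∈ N.powersetCard m, ∀ T' ∈ Q.powersetCard m, T ∩ Q ⊆ T' → φ T = ψ T') := by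
  -- Given `T`, draw `T'` uniformly among the `m`-subsets of `Q` containing `T ∩ Q`. `w a` is the
  -- reciprocal of their number when `#(T ∩ Q) = a`, so `v` is the transition kernel.
  set w : ℕ → ℝ := fun a => 1 / ((#Q - a).choose (m - a) : ℝ) with hw
  have hwpos : ∀ a, a ≤ m → 0 < w a := by
    intro a ha
    have : 0 < (#Q - a).choose (m - a) := Nat.choose_pos (by omega)
    simp only [hw]
    positivity
  set v : Finset α → Finset α → ℝ := fun T T' => if T ∩ Q ⊆ T' then w #(T ∩ Q) else 0 with hv
  have hcard : ∀ T ∈ N.powersetCard m, #(T ∩ Q) ≤ m := fun T hT =>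
    (card_le_card inter_subset_left).trans (mem_powersetCard.1 hT).2.le
  have hrow : ∀ T ∈ N.powersetCard m, ∑ T' ∈ Q.powersetCard m, v T T' = 1 := by
    intro T hT
    have hc := hcard T hT
    have hcount : #((Q.powersetCard m).filter (fun T' => T ∩ Q ⊆ T')) =
        (#Q - #(T ∩ Q)).choose (m - #(T ∩ Q)) := by
      rw [← card_sdiff_of_subset (inter_subset_right : T ∩ Q ⊆ Q), ← card_powersetCard]
      refine card_bij' (fun T' _ => T' \ (T ∩ Q)) (fun X _ => X ∪ (T ∩ Q)) ?_ ?_ ?_ ?_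
      · intro X hX
        simp only [mem_filter, mem_powersetCard] at hX ⊢
        exact ⟨sdiff_subset_sdiff hX.1.1 le_rfl, by rw [card_sdiff_of_subset hX.2, hX.1.2]⟩
      · intro X hX
        simp only [mem_filter, mem_powersetCard] at hX ⊢
        have hd : Disjoint X (T ∩ Q) := disjoint_of_subset_left hX.1 sdiff_disjoint
        refine ⟨⟨union_subset (hX.1.trans sdiff_subset) inter_subset_right, ?_⟩,
          subset_union_right⟩
        rw [card_union_of_disjoint hd, hX.2]
        omega
      · intro X hX
        simp only [mem_filter] at hX
        exact sdiff_union_of_subset hX.2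
      · intro X hX
        simp only [mem_powersetCard] at hX
        exact union_sdiff_cancel_right (disjoint_of_subset_left hX.1 sdiff_disjoint)
    simp only [hv]
    rw [← sum_filter, sum_const, hcount, nsmul_eq_mul]
    have : 0 < (#Q - #(T ∩ Q)).choose (m - #(T ∩ Q)) := Nat.choose_pos (by omega)
    simp only [hw]
    field_simp
  -- Grouping `T` by `A = T ∩ Q ⊆ T'`, both the size of a class and its weight depend only on `#A`.
  -- The column sum therefore depends on `T'` only through `#T' = m`, which makes `T'` uniform.
  obtain ⟨W, hcol⟩ : ∃ W : ℝ, ∀ T' ∈ Q.powersetCard m, ∑ T ∈ N.powersetCard m, v T T' = W := by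
    refine ⟨∑ a ∈ range (m + 1), m.choose a • (((#(N \ Q)).choose (m - a) : ℝ) * w a), ?_⟩
    intro T' hT'
    obtain ⟨hT'Q, hT'm⟩ := mem_powersetCard.1 hT'
    have hps := sum_powerset_apply_card
      (fun a => ((#(N \ Q)).choose (m - a) : ℝ) * w a) (x := T')
    rw [hT'm] at hps
    rw [← hps]
    simp only [hv]
    rw [← sum_filter, ← sum_fiberwise_of_maps_to (t := T'.powerset) (g := fun T => T ∩ Q)
      (fun T hT => mem_powerset.2 (mem_filter.1 hT).2)]
    refine sum_congr rfl fun A hA => ?_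
    have hA' := mem_powerset.1 hA
    have hAm : #A ≤ m := hT'm ▸ card_le_card hA'
    rw [sum_congr rfl (g := fun _ => w #A) (fun T hT => by rw [(mem_filter.1 hT).2]), sum_const,
      nsmul_eq_mul]
    congr 2
    rw [← card_powersetCard]
    refine card_bij' (fun T _ => T \ A) (fun X _ => X ∪ A) ?_ ?_ ?_ ?_
    · intro X hX
      simp only [mem_filter, mem_powersetCard] at hX ⊢
      obtain ⟨⟨⟨hXN, hXm⟩, -⟩, rfl⟩ := hX
      refine ⟨fun x hx => ?_, by rw [card_sdiff_of_subset inter_subset_left, hXm]⟩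
      simp only [mem_sdiff, mem_inter] at hx ⊢
      exact ⟨hXN hx.1, fun hq => hx.2 ⟨hx.1, hq⟩⟩
    · intro X hX
      simp only [mem_filter, mem_powersetCard] at hX ⊢
      have hAQ := hA'.trans hT'Q
      have hd : Disjoint X A := disjoint_of_subset_left hX.1
        (disjoint_of_subset_right hAQ sdiff_disjoint)
      have hi : (X ∪ A) ∩ Q = A := by
        ext x
        have h1 := @hX.1 x
        have h2 := @hAQ x
        simp only [mem_sdiff, mem_inter, mem_union] at h1 ⊢
        tauto
      refine ⟨⟨⟨union_subset (hX.1.trans sdiff_subset) (hAQ.trans hQN), ?_⟩, by rwa [hi]⟩, hi⟩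
      rw [card_union_of_disjoint hd, hX.2]
      omega
    · intro X hX
      simp only [mem_filter] at hX
      exact sdiff_union_of_subset (hX.2 ▸ inter_subset_left)
    · intro X hX
      simp only [mem_powersetCard] at hX
      exact union_sdiff_cancel_right (disjoint_of_subset_left hX.1
        (disjoint_of_subset_right (hA'.trans hT'Q) sdiff_disjoint))
  have hQpos : (0 : ℝ) < (#Q).choose m := by exact_mod_cast Nat.choose_pos hm
  have hNpos : (0 : ℝ) < (#N).choose m := by
    exact_mod_cast Nat.choose_pos (hm.trans (card_le_card hQN))
  -- Total mass of the kernel, by rows and by columns.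
  have hW : ((#N).choose m : ℝ) = (#Q).choose m * W := by
    have h1 := sum_congr rfl hrow
    have h2 := sum_congr rfl hcol
    rw [sum_comm, h1] at h2
    simpa using h2
  have hφ : ∑ T ∈ N.powersetCard m, φ T =
      ∑ T ∈ N.powersetCard m, ∑ T' ∈ Q.powersetCard m, v T T' * φ T :=
    sum_congr rfl fun T hT => by rw [← sum_mul, hrow T hT, one_mul]
  have hψ : W * ∑ T' ∈ Q.powersetCard m, ψ T' =
      ∑ T ∈ N.powersetCard m, ∑ T' ∈ Q.powersetCard m, v T T' * ψ T' := by
    rw [sum_comm, mul_sum]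
    exact sum_congr rfl fun T hT => by rw [← sum_mul, hcol T hT]
  have hterm : ∀ T ∈ N.powersetCard m, ∀ T' ∈ Q.powersetCard m, v T T' * ψ T' ≤ v T T' * φ T := by
    intro T hT T' hT'
    simp only [hv]
    split_ifs with hs
    · exact mul_le_mul_of_nonneg_left (h T hT T' hT' hs) (hwpos _ (hcard T hT)).le
    · simp
  have hscale : (1 / ((#Q).choose m : ℝ)) * ∑ T' ∈ Q.powersetCard m, ψ T' =
      (1 / ((#N).choose m : ℝ)) * (W * ∑ T' ∈ Q.powersetCard m, ψ T') := by
    rw [hW] at hNpos ⊢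
    have : W ≠ 0 := right_ne_zero_of_mul hNpos.ne'
    field_simp
  rw [hscale]
  constructor
  · refine mul_le_mul_of_nonneg_left ?_ (by positivity)
    rw [hφ, hψ]
    exact sum_le_sum fun T hT => sum_le_sum fun T' hT' => hterm T hT T' hT'
  · intro heq T hT T' hT' hs
    have heq' := mul_left_cancel₀ (by positivity) heq
    rw [hφ, hψ, sum_eq_sum_iff_of_le fun T hT => sum_le_sum fun T' hT' => hterm T hT T' hT'] at heq'
    have h1 := heq' T hT
    rw [sum_eq_sum_iff_of_le fun T' hT' => hterm T hT T' hT'] at h1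
    have h2 := h1 T' hT'
    simp only [hv, if_pos hs] at h2
    exact (mul_left_cancel₀ (hwpos _ (hcard T hT)).ne' h2).symm

open Finset in
theorem sum_powersetCard_succ_sum_erase {α : Type*} [DecidableEq α] (U : Finset α) (m : ℕ)
    (F : α → Finset α → ℝ) :
    ∑ S ∈ U.powersetCard (m + 1), ∑ i ∈ S, F i (S.erase i) =
      ∑ i ∈ U, ∑ T ∈ (U.erase i).powersetCard m, F i T := by
  rw [sum_sigma', sum_sigma']
  refine sum_bij' (fun x _ => ⟨x.2, x.1.erase x.2⟩) (fun x _ => ⟨insert x.1 x.2, x.1⟩) ?_ ?_ ?_ ?_ ?_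
  · rintro ⟨S, i⟩ hx
    simp only [mem_sigma, mem_powersetCard] at hx ⊢
    exact ⟨hx.1.1 hx.2, erase_subset_erase _ hx.1.1, by rw [card_erase_of_mem hx.2, hx.1.2]; simp⟩
  · rintro ⟨i, T⟩ hx
    simp only [mem_sigma, mem_powersetCard] at hx ⊢
    have hi : i ∉ T := fun hi => by simpa using hx.2.1 hi
    exact ⟨⟨insert_subset hx.1 (hx.2.1.trans (erase_subset _ _)),
      by rw [card_insert_of_notMem hi, hx.2.2]⟩, mem_insert_self _ _⟩
  · rintro ⟨S, i⟩ hx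
    simp only [mem_sigma] at hx
    simp [insert_erase hx.2]
  · rintro ⟨i, T⟩ hx
    simp only [mem_sigma, mem_powersetCard] at hx
    have hi : i ∉ T := fun hi => by simpa using hx.2.1 hi
    simp [erase_insert hi]
  · simp

/-! ### Submodular functions and Han's inequality -/

/-- The increment of the set function `g` when `i` is added to `A`. -/
def marginal {α : Type*} [DecidableEq α] (g : Finset α → ℝ) (i : α) (A : Finset α) : ℝ :=
  g (insert i A) - g A

/-- The elements of `S` that come before `i` in the order given by the rank function `r`. -/
def before {α : Type*} (r : α → ℕ) (S : Finset α) (i : α) : Finset α :=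
  S.filter fun x => r x < r i

theorem before_erase {α : Type*} [DecidableEq α] (r : α → ℕ) (S : Finset α) (i : α) :
    before r (S.erase i) i = before r S i := by
  ext x
  simp only [before, Finset.mem_filter, Finset.mem_erase]
  exact ⟨fun h => ⟨h.1.2, h.2⟩, fun h => ⟨⟨fun hx => by simp [hx] at h, h.1⟩, h.2⟩⟩

theorem notMem_before {α : Type*} (r : α → ℕ) (S : Finset α) (i : α) : i ∉ before r S i := by
  simp [before]

theorem before_subset {α : Type*} (r : α → ℕ) (S : Finset α) (i : α) : before r S i ⊆ S :=
  Finset.filter_subset _ _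

theorem before_mono {α : Type*} (r : α → ℕ) {S T : Finset α} (h : S ⊆ T) (i : α) :
    before r S i ⊆ before r T i :=
  Finset.filter_subset_filter _ h

-- Telescoping: insert the elements of `S` in increasing rank. Injectivity of `r` rules out ties.
open Finset in
theorem chain_rule {α : Type*} [DecidableEq α] (g : Finset α → ℝ) {r : α → ℕ}
    (hr : Function.Injective r) (C S : Finset α) :
    g (C ∪ S) = g C + ∑ i ∈ S, marginal g i (C ∪ before r S i) := by
  induction S using Finset.induction_on_max_value r with
  | empty => simp
  | insert a s ha hmax ih =>
    have hlt : ∀ x ∈ s, r x < r a := fun x hx =>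
      lt_of_le_of_ne (hmax x hx) fun h => ha (hr h ▸ hx)
    rw [sum_insert ha]
    have h1 : before r (insert a s) a = s := by
      rw [before, filter_insert, if_neg (lt_irrefl _), filter_true_of_mem hlt]
    have h2 : ∀ i ∈ s, before r (insert a s) i = before r s i := fun i hi => by
      rw [before, filter_insert, if_neg (hlt i hi).le.not_gt, before]
    rw [h1, sum_congr rfl fun i hi => by rw [h2 i hi], marginal, ← union_insert, ih]
    ring

open Finset in
theorem sum_powersetCard_chain_rule {α : Type*} [DecidableEq α] (g : Finset α → ℝ) {r : α → ℕ}
    (hr : Function.Injective r) (C U : Finset α) (m : ℕ) :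
    ∑ S ∈ U.powersetCard (m + 1), (g (C ∪ S) - g C) =
      ∑ i ∈ U, ∑ T ∈ (U.erase i).powersetCard m, marginal g i (C ∪ before r T i) := by
  rw [← sum_powersetCard_succ_sum_erase]
  refine sum_congr rfl fun S _ => ?_
  rw [chain_rule g hr C S]
  simp [before_erase]

/-- A submodular set function. -/
def Submodular {α : Type*} [DecidableEq α] (g : Finset α → ℝ) : Prop :=
  ∀ ⦃A B : Finset α⦄ ⦃i : α⦄, A ⊆ B → i ∉ B → marginal g i B ≤ marginal g i A

open Finset in
/-- Han's inequality, conditioned on `C`, and what equality says about a given order. -/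
theorem Submodular.han {α : Type*} [DecidableEq α] {g : Finset α → ℝ} (hg : Submodular g)
    {r : α → ℕ} (hr : Function.Injective r) {C P : Finset α} (hCP : Disjoint C P) {m : ℕ}
    (hm : m + 1 ≤ #P) :
    g (C ∪ P) ≤ g C + (1 / ((#P - 1).choose m : ℝ)) *
        ∑ S ∈ P.powersetCard (m + 1), (g (C ∪ S) - g C) ∧
      (g (C ∪ P) = g C + (1 / ((#P - 1).choose m : ℝ)) *
          ∑ S ∈ P.powersetCard (m + 1), (g (C ∪ S) - g C) ↔
        ∀ i ∈ P, ∀ T ∈ (P.erase i).powersetCard m,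
          marginal g i (C ∪ before r P i) = marginal g i (C ∪ before r T i)) := by
  have hpos : (0 : ℝ) < (#P - 1).choose m := by exact_mod_cast Nat.choose_pos (by omega)
  have hc : ∀ i ∈ P, #((P.erase i).powersetCard m) = (#P - 1).choose m := fun i hi => by
    rw [card_powersetCard, card_erase_of_mem hi]
  have hL : g (C ∪ P) = g C + (1 / ((#P - 1).choose m : ℝ)) *
      ∑ i ∈ P, ∑ T ∈ (P.erase i).powersetCard m, marginal g i (C ∪ before r P i) := by
    rw [chain_rule g hr C P, mul_sum]
    congr 1
    refine sum_congr rfl fun i hi => ?_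
    rw [sum_const, hc i hi, nsmul_eq_mul]
    field_simp
  have hterm : ∀ i ∈ P, ∀ T ∈ (P.erase i).powersetCard m,
      marginal g i (C ∪ before r P i) ≤ marginal g i (C ∪ before r T i) := by
    intro i hi T hT
    have hTP := (mem_powersetCard.1 hT).1.trans (erase_subset i P)
    refine hg (union_subset_union le_rfl (before_mono r hTP i)) ?_
    rw [mem_union, not_or]
    exact ⟨disjoint_right.1 hCP hi, notMem_before r P i⟩
  rw [hL, sum_powersetCard_chain_rule g hr C P m]
  refine ⟨?_, ?_⟩
  · gcongr with i hi T hT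
    exact hterm i hi T hT
  · rw [add_right_inj, mul_right_inj' (by positivity),
      sum_eq_sum_iff_of_le fun i hi => sum_le_sum (hterm i hi)]
    exact forall₂_congr fun i hi => sum_eq_sum_iff_of_le (hterm i hi)

open Finset in
/-- The conditional Han bound is at most the unconditional one, and what equality says about a given
order in which `C` precedes `P`. -/
theorem Submodular.conditional_han_le {α : Type*} [DecidableEq α] {g : Finset α → ℝ}
    (hg : Submodular g) (h0 : g ∅ = 0) {r : α → ℕ} (hr : Function.Injective r) {C P : Finset α}
    (hCP : ∀ i ∈ C, ∀ j ∈ P, r i < r j) {m : ℕ} (hm : m + 1 ≤ #P) :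
    g C + (1 / ((#P - 1).choose m : ℝ)) * ∑ S ∈ P.powersetCard (m + 1), (g (C ∪ S) - g C) ≤
        (1 / ((#(C ∪ P) - 1).choose m : ℝ)) * ∑ S ∈ (C ∪ P).powersetCard (m + 1), g S ∧
      (g C + (1 / ((#P - 1).choose m : ℝ)) * ∑ S ∈ P.powersetCard (m + 1), (g (C ∪ S) - g C) =
          (1 / ((#(C ∪ P) - 1).choose m : ℝ)) * ∑ S ∈ (C ∪ P).powersetCard (m + 1), g S →
        (∀ i ∈ C, marginal g i (before r C i) = marginal g i ∅) ∧
        ∀ i ∈ P, ∀ T ∈ ((C ∪ P).erase i).powersetCard m, ∀ T' ∈ (P.erase i).powersetCard m,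
          T ∩ P.erase i ⊆ T' →
            marginal g i (before r T i) = marginal g i (C ∪ before r T' i)) := by
  have hdisj : Disjoint C P := disjoint_left.2 fun i hi hj => lt_irrefl _ (hCP i hi i hj)
  have hPN : #P ≤ #(C ∪ P) := card_le_card subset_union_right
  set N : ℝ := ((#(C ∪ P) - 1).choose m : ℝ) with hN
  have hpos : (0 : ℝ) < N := by rw [hN]; exact_mod_cast Nat.choose_pos (by omega)
  have hR : (1 / N) * ∑ S ∈ (C ∪ P).powersetCard (m + 1), g S =
      ∑ i ∈ C, (1 / N) * ∑ T ∈ ((C ∪ P).erase i).powersetCard m, marginal g i (before r T i) +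
      ∑ i ∈ P, (1 / N) * ∑ T ∈ ((C ∪ P).erase i).powersetCard m, marginal g i (before r T i) := by
    have := sum_powersetCard_chain_rule g hr ∅ (C ∪ P) m
    simp only [empty_union, h0, sub_zero] at this
    rw [this, sum_union hdisj, mul_add, mul_sum, mul_sum]
  have hL : g C + (1 / ((#P - 1).choose m : ℝ)) *
        ∑ S ∈ P.powersetCard (m + 1), (g (C ∪ S) - g C) =
      ∑ i ∈ C, marginal g i (before r C i) +
      ∑ i ∈ P, (1 / ((#P - 1).choose m : ℝ)) *
        ∑ T ∈ (P.erase i).powersetCard m, marginal g i (C ∪ before r T i) := by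
    have := chain_rule g hr ∅ C
    simp only [empty_union, h0, zero_add] at this
    rw [sum_powersetCard_chain_rule g hr C P m, mul_sum, ← this]
  have hbefore : ∀ i ∈ C, ∀ T ⊆ C ∪ P, before r T i ⊆ before r C i := by
    intro i hi T hT x hx
    simp only [before, mem_filter] at hx ⊢
    refine ⟨(mem_union.1 (hT hx.1)).resolve_right fun hxP => ?_, hx.2⟩
    exact absurd hx.2 (hCP i hi x hxP).le.not_gt
  have hCterm : ∀ i ∈ C, ∀ T ∈ ((C ∪ P).erase i).powersetCard m,
      marginal g i (before r C i) ≤ marginal g i (before r T i) := fun i hi T hT =>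
    hg (hbefore i hi T ((mem_powersetCard.1 hT).1.trans (erase_subset _ _))) (notMem_before r C i)
  have hCconst : ∀ i ∈ C, marginal g i (before r C i) =
      (1 / N) * ∑ T ∈ ((C ∪ P).erase i).powersetCard m, marginal g i (before r C i) := by
    intro i hi
    rw [sum_const, card_powersetCard, card_erase_of_mem (mem_union_left _ hi), nsmul_eq_mul, ← hN]
    field_simp
  have hCle : ∀ i ∈ C, marginal g i (before r C i) ≤
      (1 / N) * ∑ T ∈ ((C ∪ P).erase i).powersetCard m, marginal g i (before r T i) := by
    intro i hi
    rw [hCconst i hi]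
    gcongr with T hT
    exact hCterm i hi T hT
  have hP := fun i (hi : i ∈ P) => average_powersetCard_le (N := (C ∪ P).erase i) (Q := P.erase i)
    (erase_subset_erase i subset_union_right) (m := m) (by rw [card_erase_of_mem hi]; omega)
    (fun T => marginal g i (before r T i)) (fun T => marginal g i (C ∪ before r T i)) (by
      intro T hT T' hT' hTT'
      refine hg ?_ ?_
      · intro x hx
        simp only [before, mem_filter, mem_union] at hx ⊢
        have hx' := (mem_powersetCard.1 hT).1 hx.1
        rw [mem_erase, mem_union] at hx'
        exact hx'.2.imp_right fun h =>
          ⟨hTT' (mem_inter.2 ⟨hx.1, mem_erase.2 ⟨hx'.1, h⟩⟩), hx.2⟩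
      · rw [mem_union, not_or]
        exact ⟨disjoint_right.1 hdisj hi, notMem_before r T' i⟩)
  have hPle : ∀ i ∈ P, (1 / ((#P - 1).choose m : ℝ)) *
        ∑ T ∈ (P.erase i).powersetCard m, marginal g i (C ∪ before r T i) ≤
      (1 / N) * ∑ T ∈ ((C ∪ P).erase i).powersetCard m, marginal g i (before r T i) := by
    intro i hi
    have := (hP i hi).1
    rwa [card_erase_of_mem hi, card_erase_of_mem (mem_union_right C hi)] at this
  rw [hL, hR]
  refine ⟨add_le_add (sum_le_sum hCle) (sum_le_sum hPle), fun heq => ?_⟩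
  rw [add_eq_add_iff_eq_and_eq (sum_le_sum hCle) (sum_le_sum hPle), sum_eq_sum_iff_of_le hCle,
    sum_eq_sum_iff_of_le hPle] at heq
  refine ⟨fun i hi => ?_, fun i hi => ?_⟩
  · have h1 := heq.1 i hi
    nth_rewrite 1 [hCconst i hi] at h1
    have h2 := mul_left_cancel₀ (by positivity) h1
    rw [sum_eq_sum_iff_of_le (hCterm i hi)] at h2
    -- A `T` inside `P` contains nothing that precedes `i ∈ C`, so its term is the unconditioned
    -- marginal.
    obtain ⟨T, hTP, hTm⟩ := exists_subset_card_eq (s := P) (n := m) (by omega)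
    have hiT : i ∉ T := fun h => disjoint_left.1 hdisj hi (hTP h)
    rw [h2 T (mem_powersetCard.2
      ⟨subset_erase.2 ⟨hTP.trans subset_union_right, hiT⟩, hTm⟩)]
    congr 1
    exact filter_eq_empty_iff.2 fun x hx => (hCP i hi x (hTP hx)).le.not_gt
  · have := (hP i hi).2
    rw [card_erase_of_mem hi, card_erase_of_mem (mem_union_right C hi)] at this
    exact this (heq.2 i hi)

/-! ### Residuals and submodularity of the log-minor -/

/-- `r` is the residual of the regression of the `i`-th variable on those in `A`: it is
`K`-orthogonal to the coordinates in `A` and differs from the `i`-th unit vector only on `A`. -/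
structure IsResidual {n : ℕ} (K : Matrix (Fin n) (Fin n) ℝ) (i : Fin n) (A : Finset (Fin n))
    (r : Fin n → ℝ) : Prop where
  apply_self : r i = 1
  apply_eq_zero : ∀ j, j ∉ insert i A → r j = 0
  mulVec_eq_zero : ∀ a ∈ A, (K.mulVec r) a = 0

section

variable {n : ℕ} {K : Matrix (Fin n) (Fin n) ℝ}

theorem posDef_subMat (hK : K.PosDef) (S : Finset (Fin n)) : (subMat K S S).PosDef :=
  hK.submatrix Subtype.val_injective

theorem minorDet_pos (hK : K.PosDef) (S : Finset (Fin n)) : 0 < minorDet K S :=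
  (posDef_subMat hK S).det_pos

theorem minorDet_empty : minorDet K ∅ = 1 := Matrix.det_isEmpty

theorem minorDet_univ : minorDet K Finset.univ = K.det := by
  exact Matrix.det_submatrix_equiv_self
    (Equiv.subtypeUnivEquiv (p := (· ∈ Finset.univ)) Finset.mem_univ) K

/-- Solve the normal equations on `A`. Bordering `K(A)` by `i` multiplies the determinant by a
scalar Schur complement, which is the residual variance `(K r) i`. -/
theorem exists_residual (hK : K.PosDef) {i : Fin n} {A : Finset (Fin n)} (hi : i ∉ A) :
    ∃ r, IsResidual K i A r ∧ minorDet K (insert i A) = minorDet K A * (K.mulVec r) i ∧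
      ∀ j, (K.mulVec r) j =
        K j i - ∑ a : A, K j a * ((subMat K A A)⁻¹.mulVec fun b : A => K b i) a := by
  set x : A → ℝ := (subMat K A A)⁻¹.mulVec fun b : A => K b i with hx
  set r : Fin n → ℝ := fun j => if j = i then 1 else if h : j ∈ A then -x ⟨j, h⟩ else 0 with hr
  have hmul : ∀ j, (K.mulVec r) j = K j i - ∑ a : A, K j a * x a := by
    intro j
    have h1 : (K.mulVec r) j = ∑ l ∈ insert i A, K j l * r l := by
      refine (Finset.sum_subset (Finset.subset_univ (insert i A)) fun l _ hl => ?_).symm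
      rw [Finset.mem_insert, not_or] at hl
      simp [hr, hl.1, hl.2]
    rw [h1, Finset.sum_insert hi, ← Finset.sum_coe_sort A, sub_eq_add_neg, ← Finset.sum_neg_distrib]
    congr 1
    · simp [hr]
    · refine Finset.sum_congr rfl fun a _ => ?_
      have : (a : Fin n) ≠ i := fun h => hi (h ▸ a.2)
      simp [hr, this]
  have hunit : IsUnit (subMat K A A).det := (minorDet_pos hK A).ne'.isUnit
  refine ⟨r, ⟨by simp [hr], fun j hj => ?_, fun a ha => ?_⟩, ?_, hmul⟩
  · rw [Finset.mem_insert, not_or] at hj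
    simp [hr, hj.1, hj.2]
  · have h2 : (subMat K A A).mulVec x = fun b : A => K b i := by
      rw [hx, Matrix.mulVec_mulVec, Matrix.mul_nonsing_inv _ hunit, Matrix.one_mulVec]
    rw [hmul a, sub_eq_zero]
    exact (congrFun h2 ⟨a, ha⟩).symm
  · let e : A ⊕ Unit ≃ (insert i A : Finset (Fin n)) :=
      ((Finset.subtypeInsertEquivOption hi).trans (Equiv.optionEquivSumPUnit _)).symm
    have hdet : minorDet K (insert i A) =
        (Matrix.fromBlocks (subMat K A A) (Matrix.of fun (b : A) (_ : Unit) => K b i)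
          (Matrix.of fun (_ : Unit) (b : A) => K i b) (Matrix.of fun _ _ : Unit => K i i)).det := by
      rw [minorDet, ← Matrix.det_submatrix_equiv_self e]
      congr 1
      ext (a | a) (b | b) <;> rfl
    let _ := Matrix.invertibleOfIsUnitDet _ hunit
    rw [hdet, Matrix.det_fromBlocks₁₁, hmul i, Matrix.invOf_eq_nonsing_inv, Matrix.mul_assoc,
      Matrix.det_unique (n := Unit)]
    rfl

theorem IsResidual.quadratic {i : Fin n} {A : Finset (Fin n)} {r : Fin n → ℝ}
    (hr : IsResidual K i A r) : r ⬝ᵥ K.mulVec r = (K.mulVec r) i := by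
  rw [dotProduct, Finset.sum_eq_single i]
  · rw [hr.apply_self, one_mul]
  · intro j _ hj
    by_cases hA : j ∈ A
    · rw [hr.mulVec_eq_zero j hA, mul_zero]
    · rw [hr.apply_eq_zero j (by simp [hj, hA]), zero_mul]
  · simp

/-- Pythagoras: `r - s` is supported in `B`, where `K s` vanishes. -/
theorem IsResidual.quadratic_sub (hK : K.PosDef) {i : Fin n} {A B : Finset (Fin n)} (hAB : A ⊆ B)
    {r s : Fin n → ℝ} (hr : IsResidual K i A r) (hs : IsResidual K i B s) :
    (K.mulVec r) i = (K.mulVec s) i + (r - s) ⬝ᵥ K.mulVec (r - s) := by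
  have horth : (r - s) ⬝ᵥ K.mulVec s = 0 := by
    refine Finset.sum_eq_zero fun j _ => ?_
    by_cases hB : j ∈ B
    · rw [hs.mulVec_eq_zero j hB, mul_zero]
    · by_cases hj : j = i
      · simp [hj, hr.apply_self, hs.apply_self]
      · have hA : j ∉ A := fun h => hB (hAB h)
        simp [hr.apply_eq_zero j (by simp [hj, hA]), hs.apply_eq_zero j (by simp [hj, hB])]
  have hsymm : s ⬝ᵥ K.mulVec (r - s) = (r - s) ⬝ᵥ K.mulVec s := by
    have hT : K.transpose = K := by simpa using hK.isHermitian.eq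
    rw [Matrix.dotProduct_mulVec, dotProduct_comm, ← Matrix.mulVec_transpose, hT]
  have hsplit : r ⬝ᵥ K.mulVec r =
      s ⬝ᵥ K.mulVec s + (r - s) ⬝ᵥ K.mulVec s + s ⬝ᵥ K.mulVec (r - s) +
        (r - s) ⬝ᵥ K.mulVec (r - s) := by
    simp only [Matrix.mulVec_sub, sub_dotProduct, dotProduct_sub]
    ring
  rw [← hr.quadratic, ← hs.quadratic, hsplit, hsymm, horth]
  ring

theorem IsResidual.eq_of_eq (hK : K.PosDef) {i : Fin n} {A B : Finset (Fin n)} (hAB : A ⊆ B)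
    {r s : Fin n → ℝ} (hr : IsResidual K i A r) (hs : IsResidual K i B s)
    (h : (K.mulVec r) i = (K.mulVec s) i) : r = s := by
  by_contra hne
  have := hK.dotProduct_mulVec_pos (sub_ne_zero.2 hne)
  rw [star_trivial] at this
  linarith [hr.quadratic_sub hK hAB hs]

theorem IsResidual.le (hK : K.PosDef) {i : Fin n} {A B : Finset (Fin n)} (hAB : A ⊆ B)
    {r s : Fin n → ℝ} (hr : IsResidual K i A r) (hs : IsResidual K i B s) :
    (K.mulVec s) i ≤ (K.mulVec r) i := by
  have := hK.posSemidef.dotProduct_mulVec_nonneg (r - s)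
  rw [star_trivial] at this
  linarith [hr.quadratic_sub hK hAB hs]

theorem IsResidual.unique (hK : K.PosDef) {i : Fin n} {A : Finset (Fin n)}
    {r s : Fin n → ℝ} (hr : IsResidual K i A r) (hs : IsResidual K i A s) : r = s :=
  hr.eq_of_eq hK le_rfl hs ((hs.le hK le_rfl hr).antisymm (hr.le hK le_rfl hs))

theorem IsResidual.minorDet_insert (hK : K.PosDef) {i : Fin n} {A : Finset (Fin n)} (hi : i ∉ A)
    {r : Fin n → ℝ} (hr : IsResidual K i A r) :
    minorDet K (insert i A) = minorDet K A * (K.mulVec r) i := by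
  obtain ⟨s, hs, hd, -⟩ := exists_residual hK hi
  rwa [hr.unique hK hs]

theorem IsResidual.mulVec_pos (hK : K.PosDef) {i : Fin n} {A : Finset (Fin n)} (hi : i ∉ A)
    {r : Fin n → ℝ} (hr : IsResidual K i A r) : 0 < (K.mulVec r) i :=
  pos_of_mul_pos_right (hr.minorDet_insert hK hi ▸ minorDet_pos hK _) (minorDet_pos hK A).le

/-- The logarithm of a principal minor, as a function of the index set. -/
noncomputable def logMinor (K : Matrix (Fin n) (Fin n) ℝ) (S : Finset (Fin n)) : ℝ :=
  Real.log (minorDet K S)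

theorem logMinor_empty : logMinor K ∅ = 0 := by simp [logMinor, minorDet_empty]

theorem exp_logMinor (hK : K.PosDef) (S : Finset (Fin n)) :
    Real.exp (logMinor K S) = minorDet K S :=
  Real.exp_log (minorDet_pos hK S)

theorem IsResidual.marginal_eq (hK : K.PosDef) {i : Fin n} {A : Finset (Fin n)} (hi : i ∉ A)
    {r : Fin n → ℝ} (hr : IsResidual K i A r) :
    marginal (logMinor K) i A = Real.log ((K.mulVec r) i) := by
  rw [marginal, logMinor, logMinor, hr.minorDet_insert hK hi,
    Real.log_mul (minorDet_pos hK A).ne' (hr.mulVec_pos hK hi).ne']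
  ring

theorem submodular_logMinor (hK : K.PosDef) : Submodular (logMinor K) := by
  intro A B i hAB hi
  have hiA : i ∉ A := fun h => hi (hAB h)
  obtain ⟨r, hr, -⟩ := exists_residual hK hiA
  obtain ⟨s, hs, -⟩ := exists_residual hK hi
  rw [hr.marginal_eq hK hiA, hs.marginal_eq hK hi]
  exact Real.log_le_log (hs.mulVec_pos hK hi) (hr.le hK hAB hs)

theorem IsResidual.eq_of_marginal_eq (hK : K.PosDef) {i : Fin n} {A B : Finset (Fin n)}
    (hAB : A ⊆ B) (hi : i ∉ B) {r s : Fin n → ℝ} (hr : IsResidual K i A r)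
    (hs : IsResidual K i B s)
    (h : marginal (logMinor K) i A = marginal (logMinor K) i B) : r = s := by
  have hiA : i ∉ A := fun h => hi (hAB h)
  rw [hr.marginal_eq hK hiA, hs.marginal_eq hK hi] at h
  exact hr.eq_of_eq hK hAB hs
    (Real.log_injOn_pos (hr.mulVec_pos hK hiA) (hs.mulVec_pos hK hi) h)

theorem isResidual_single {i : Fin n} {A : Finset (Fin n)} (h : ∀ a ∈ A, K a i = 0) :
    IsResidual K i A (Pi.single i 1) where
  apply_self := by simp
  apply_eq_zero j hj := by
    rw [Finset.mem_insert, not_or] at hj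
    simp [hj.1]
  mulVec_eq_zero a ha := by simp [h a ha]

theorem marginal_eq_log_diag (hK : K.PosDef) {i : Fin n} {A : Finset (Fin n)} (hi : i ∉ A)
    (h : ∀ a ∈ A, K a i = 0) : marginal (logMinor K) i A = Real.log (K i i) := by
  rw [(isResidual_single h).marginal_eq hK hi]
  simp

/-- If conditioning on more variables does not change the marginal of the empty condition, the
variables are uncorrelated. -/
theorem apply_eq_zero_of_marginal_eq (hK : K.PosDef) {i : Fin n} {A : Finset (Fin n)} (hi : i ∉ A)
    (h : marginal (logMinor K) i A = marginal (logMinor K) i ∅) : ∀ a ∈ A, K a i = 0 := by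
  obtain ⟨s, hs, -⟩ := exists_residual hK hi
  have h0 : IsResidual K i ∅ (Pi.single i 1) := isResidual_single (by simp)
  have := h0.eq_of_marginal_eq hK (Finset.empty_subset A) hi hs h.symm
  intro a ha
  have h1 := hs.mulVec_eq_zero a ha
  rw [← this] at h1
  simpa using h1

theorem IsResidual.mulVec_eq_schurCompl (hK : K.PosDef) {P : Finset (Fin n)} (i j : P)
    {r : Fin n → ℝ} (hr : IsResidual K i Pᶜ r) : (K.mulVec r) j = schurCompl K P j i := by
  obtain ⟨s, hs, -, h⟩ := exists_residual hK (i := i) (A := Pᶜ) (by simp)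
  rw [hr.unique hK hs, h, schurCompl, Matrix.mul_assoc]
  rfl

end

/-! ### Equality cases -/

theorem before_insert_eq_singleton {α : Type*} [DecidableEq α] {r : α → ℕ} {T : Finset α} {a i : α}
    (ha : r a < r i) (hT : ∀ x ∈ T, r i < r x) : before r (insert a T) i = {a} := by
  rw [before, Finset.filter_insert, if_pos ha,
    Finset.filter_eq_empty_iff.2 fun x hx => (hT x hx).le.not_gt]
  rfl

open Finset in
theorem sum_powersetCard_succ_sum {α : Type*} [DecidableEq α] (U : Finset α) (m : ℕ) (d : α → ℝ) :
    ∑ S ∈ U.powersetCard (m + 1), ∑ i ∈ S, d i = ((#U - 1).choose m : ℝ) * ∑ i ∈ U, d i := by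
  rw [sum_powersetCard_succ_sum_erase U m fun i _ => d i, mul_sum]
  refine sum_congr rfl fun i hi => ?_
  rw [sum_const, card_powersetCard, card_erase_of_mem hi, nsmul_eq_mul]

section

variable {n : ℕ} {K : Matrix (Fin n) (Fin n) ℝ}

theorem logMinor_union_of_uncorrelated (hK : K.PosDef) (C S : Finset (Fin n)) (hCS : Disjoint C S)
    (h : ∀ i ∈ S, ∀ a ∈ C ∪ S, a ≠ i → K a i = 0) :
    logMinor K (C ∪ S) = logMinor K C + ∑ i ∈ S, Real.log (K i i) := by
  rw [chain_rule (logMinor K) (Fin.val_injective) C S]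
  congr 1
  refine Finset.sum_congr rfl fun i hi => ?_
  have hi' : i ∉ C ∪ before Fin.val S i := by
    rw [Finset.mem_union, not_or]
    exact ⟨Finset.disjoint_right.1 hCS hi, notMem_before _ _ _⟩
  exact marginal_eq_log_diag hK hi' fun a ha =>
    h i hi a (Finset.union_subset_union le_rfl (before_subset _ _ _) ha) fun hai => hi' (hai ▸ ha)

theorem logMinor_of_uncorrelated (hK : K.PosDef) (S : Finset (Fin n))
    (h : ∀ i ∈ S, ∀ a ∈ S, a ≠ i → K a i = 0) :
    logMinor K S = ∑ i ∈ S, Real.log (K i i) := by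
  have := logMinor_union_of_uncorrelated hK ∅ S (Finset.disjoint_empty_left S)
    (by simpa only [Finset.empty_union] using h)
  rwa [Finset.empty_union, logMinor_empty, zero_add] at this

-- In an order with `i` last, equality makes the residual of `i` on all other indices coincide with
-- its residual on `Pᶜ ∪ T` for every `m`-subset `T` of `P \ {i}`. It is thus already the residual
-- on `Pᶜ`, and its image under `K` gives column `i` of the Schur complement.
open Finset in
theorem schurCompl_isDiag_of_han_eq (hK : K.PosDef) {P : Finset (Fin n)} {m : ℕ}
    (hm : m + 1 < #P)
    (h : logMinor K (Pᶜ ∪ P) = logMinor K Pᶜ + (1 / ((#P - 1).choose m : ℝ)) *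
      ∑ S ∈ P.powersetCard (m + 1), (logMinor K (Pᶜ ∪ S) - logMinor K Pᶜ)) :
    (schurCompl K P).IsDiag := by
  have hdisj : Disjoint Pᶜ P := disjoint_compl_left
  intro j i hji
  have hji' : (j : Fin n) ≠ i := fun h => hji (Subtype.ext h)
  have hle : Pᶜ ⊆ univ.erase (i : Fin n) := subset_erase.2 ⟨subset_univ _, by simp⟩
  have hni : (i : Fin n) ∉ univ.erase (i : Fin n) := by simp
  obtain ⟨s, hs, -⟩ := exists_residual hK hni
  -- Rank `n` exceeds every index, so `i` comes last.
  have hinj : Function.Injective fun x : Fin n => if x = i then n else (x : ℕ) := by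
    intro x y hxy
    have := x.2
    have := y.2
    dsimp only at hxy
    split_ifs at hxy with h1 h2 h2
    · rw [h1, h2]
    · omega
    · omega
    · exact Fin.ext hxy
  have hbefore : ∀ S : Finset (Fin n),
      before (fun x : Fin n => if x = i then n else (x : ℕ)) S i = S.erase i := by
    intro S
    ext x
    have := x.2
    by_cases hx : x = i <;> simp [before, hx]
  have hzero : ∀ l ∈ P.erase (i : Fin n), s l = 0 := by
    intro l hl
    -- The strict bound `m + 1 < #P` leaves room for `T` to avoid both `i` and `l`; the residual on
    -- `Pᶜ ∪ T` then vanishes at `l`.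
    obtain ⟨T, hT, hTm⟩ := exists_subset_card_eq (s := (P.erase (i : Fin n)).erase l) (n := m)
      (by rw [card_erase_of_mem hl, card_erase_of_mem i.2]; omega)
    have hTi := hT.trans (erase_subset _ _)
    have hiT : (i : Fin n) ∉ T := fun h => by simpa using hTi h
    have hmarg := ((submodular_logMinor hK).han hinj hdisj hm.le).2.1 h i i.2 T
      (mem_powersetCard.2 ⟨hTi, hTm⟩)
    have hCP : Pᶜ ∪ P.erase (i : Fin n) = univ.erase (i : Fin n) := by
      ext x
      by_cases hx : x = i <;> simp [hx, em']
    rw [hbefore, hbefore, erase_eq_of_notMem hiT, hCP] at hmarg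
    have hsub : Pᶜ ∪ T ⊆ univ.erase (i : Fin n) :=
      union_subset hle (hTi.trans (erase_subset_erase _ (subset_univ _)))
    obtain ⟨r, hr, -⟩ := exists_residual hK fun h => hni (hsub h)
    rw [← hr.eq_of_marginal_eq hK hsub hni hs hmarg.symm]
    refine hr.apply_eq_zero l ?_
    have hlP := mem_of_mem_erase hl
    have hlT : l ∉ T := fun h => by simpa using hT h
    simp [ne_of_mem_erase hl, hlP, hlT]
  have hsC : IsResidual K i Pᶜ s := by
    refine ⟨hs.apply_self, fun l hl => ?_, fun a ha => hs.mulVec_eq_zero a (hle ha)⟩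
    rw [mem_insert, not_or, mem_compl, not_not] at hl
    exact hzero l (mem_erase.2 hl)
  rw [← hsC.mulVec_eq_schurCompl hK i j]
  exact hs.mulVec_eq_zero j (by simpa using hji')

-- With a diagonal Schur complement, the residual of `i` on `Pᶜ` is also its residual on `Pᶜ ∪ A`
-- for `A ⊆ P \ {i}`, so all the marginals compared in Han's inequality agree.
open Finset in
theorem han_eq_of_schurCompl_isDiag (hK : K.PosDef) {P : Finset (Fin n)} {m : ℕ}
    (hm : m + 1 ≤ #P) (h : (schurCompl K P).IsDiag) :
    logMinor K (Pᶜ ∪ P) = logMinor K Pᶜ + (1 / ((#P - 1).choose m : ℝ)) *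
      ∑ S ∈ P.powersetCard (m + 1), (logMinor K (Pᶜ ∪ S) - logMinor K Pᶜ) := by
  refine ((submodular_logMinor hK).han Fin.val_injective disjoint_compl_left hm).2.2 ?_
  intro i hi T hT
  have hkey : ∀ A ⊆ P, i ∉ A →
      marginal (logMinor K) i (Pᶜ ∪ A) = marginal (logMinor K) i Pᶜ := by
    intro A hA hiA
    have hiC : i ∉ Pᶜ := by simpa using hi
    obtain ⟨r, hr, -⟩ := exists_residual hK hiC
    have hrA : IsResidual K i (Pᶜ ∪ A) r := by
      refine ⟨hr.apply_self, fun l hl => hr.apply_eq_zero l fun hl' => hl ?_, fun a ha => ?_⟩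
      · exact insert_subset_insert _ subset_union_left hl'
      · rcases mem_union.1 ha with ha | ha
        · exact hr.mulVec_eq_zero a ha
        · rw [hr.mulVec_eq_schurCompl hK ⟨i, hi⟩ ⟨a, hA ha⟩]
          have hai : a ≠ i := fun hai => hiA (hai ▸ ha)
          exact h fun he => hai (congrArg Subtype.val he)
    rw [hr.marginal_eq hK hiC, hrA.marginal_eq hK (by simp [hi, hiA])]
  have hTP := (mem_powersetCard.1 hT).1.trans (erase_subset _ _)
  rw [hkey _ (before_subset _ _ _) (notMem_before _ _ _),
    hkey _ ((before_subset _ _ _).trans hTP) (notMem_before _ _ _)]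

-- When `g` is additive on the sets involved, both sides reduce to the sum of `d` over `C ∪ P`.
open Finset in
theorem conditional_han_eq_of_sum {g : Finset (Fin n) → ℝ} {C P : Finset (Fin n)}
    (hdisj : Disjoint C P) {m : ℕ} (hm : m + 1 ≤ #P) (d : Fin n → ℝ) (hC : g C = ∑ i ∈ C, d i)
    (hP : ∀ S ∈ P.powersetCard (m + 1), g (C ∪ S) = g C + ∑ i ∈ S, d i)
    (hS : ∀ S ∈ (C ∪ P).powersetCard (m + 1), g S = ∑ i ∈ S, d i) :
    g C + (1 / ((#P - 1).choose m : ℝ)) * ∑ S ∈ P.powersetCard (m + 1), (g (C ∪ S) - g C) =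
      (1 / ((#(C ∪ P) - 1).choose m : ℝ)) * ∑ S ∈ (C ∪ P).powersetCard (m + 1), g S := by
  have hPN : #P ≤ #(C ∪ P) := card_le_card subset_union_right
  have h1 : ((#P - 1).choose m : ℝ) ≠ 0 := by exact_mod_cast (Nat.choose_pos (by omega)).ne'
  have h2 : ((#(C ∪ P) - 1).choose m : ℝ) ≠ 0 := by exact_mod_cast (Nat.choose_pos (by omega)).ne'
  rw [sum_congr rfl hS, sum_congr rfl (g := fun S => ∑ i ∈ S, d i)
    (fun S hS => by rw [hP S hS]; ring), sum_powersetCard_succ_sum, sum_powersetCard_succ_sum,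
    sum_union hdisj, hC]
  field_simp

/-- The order in which `C` comes first, then `j`, then `i`, then the rest. -/
def rankAfter (C : Finset (Fin n)) (j i x : Fin n) : ℕ :=
  if x ∈ C then x else if x = j then n else if x = i then n + 1 else n + 2 + x

theorem rankAfter_injective (C : Finset (Fin n)) (j i : Fin n) :
    Function.Injective (rankAfter C j i) := by
  intro x y hxy
  have := x.2
  have := y.2
  unfold rankAfter at hxy
  split_ifs at hxy <;> omega

theorem rankAfter_lt {C : Finset (Fin n)} (j i : Fin n) {x y : Fin n} (hx : x ∈ C) (hy : y ∉ C) :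
    rankAfter C j i x < rankAfter C j i y := by
  have := x.2
  unfold rankAfter
  split_ifs <;> omega

theorem apply_eq_zero_of_before (hK : K.PosDef) {C : Finset (Fin n)} {r : Fin n → ℕ}
    (hr : Function.Injective r)
    (h : ∀ i ∈ C, marginal (logMinor K) i (before r C i) = marginal (logMinor K) i ∅) :
    ∀ i ∈ C, ∀ j ∈ C, i ≠ j → K i j = 0 := by
  have hlt : ∀ i ∈ C, ∀ j ∈ C, r i < r j → K i j = 0 := fun i hi j hj hij =>
    apply_eq_zero_of_marginal_eq hK (notMem_before r C j) (h j hj) i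
      (Finset.mem_filter.2 ⟨hi, hij⟩)
  intro i hi j hj hij
  rcases lt_or_gt_of_ne (hr.ne hij) with hlt' | hlt'
  · exact hlt i hi j hj hlt'
  · rw [← hK.isHermitian.apply, hlt j hj i hi hlt', star_zero]

-- In the order `C`, `j`, `i`, rest, equality identifies the residuals of `i` on `{j}`, on `{q}`
-- with `q ∈ C`, and on `C ∪ {j}`. The common vector is supported in `{i, j} ∩ {i, q} = {i}`, so it
-- is the unit vector.
open Finset in
theorem uncorrelated_of_conditional_han_eq (hK : K.PosDef) {C P : Finset (Fin n)}
    (hdisj : Disjoint C P) {m : ℕ} (hm1 : 1 ≤ m) (hm : m + 1 ≤ #P) (hC : C.Nonempty)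
    (h : logMinor K C + (1 / ((#P - 1).choose m : ℝ)) *
        ∑ S ∈ P.powersetCard (m + 1), (logMinor K (C ∪ S) - logMinor K C) =
      (1 / ((#(C ∪ P) - 1).choose m : ℝ)) * ∑ S ∈ (C ∪ P).powersetCard (m + 1), logMinor K S)
    {i j : Fin n} (hi : i ∈ P) (hj : j ∈ P) (hij : i ≠ j) :
    ∀ a ∈ C ∪ {j}, K a i = 0 := by
  have hg := submodular_logMinor hK
  obtain ⟨q, hq⟩ := hC
  have hiC : i ∉ C := disjoint_right.1 hdisj hi
  have hjC : j ∉ C := disjoint_right.1 hdisj hj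
  set r := rankAfter C j i with hr
  have hlt : ∀ x ∈ C, ∀ y ∈ P, r x < r y := fun x hx y hy =>
    rankAfter_lt j i hx (disjoint_right.1 hdisj hy)
  have hmarg := ((hg.conditional_han_le logMinor_empty (rankAfter_injective C j i) hlt hm).2 h).2
    i hi
  -- `T` follows `i` in the order, and its size `m - 1` leaves one slot, filled by `j` or by `q`,
  -- for the only predecessor of `i`. This is where `1 ≤ m` matters.
  obtain ⟨T, hT, hTm⟩ := exists_subset_card_eq (s := (P.erase i).erase j) (n := m - 1)
    (by rw [card_erase_of_mem (mem_erase.2 ⟨hij.symm, hj⟩), card_erase_of_mem hi]; omega)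
  have hTP : ∀ x ∈ T, x ∈ P ∧ x ≠ i ∧ x ≠ j := fun x hx => by
    have := hT hx
    simp only [mem_erase] at this
    tauto
  have hjT : j ∉ T := fun h => (hTP j h).2.2 rfl
  have hqT : q ∉ T := fun h => disjoint_left.1 hdisj hq (hTP q h).1
  have hrji : r j < r i := by simp [hr, rankAfter, hiC, hjC, hij]
  have hrT : ∀ x ∈ T, r i < r x := by
    intro x hx
    obtain ⟨h1, h2, h3⟩ := hTP x hx
    simp [hr, rankAfter, hiC, hij, disjoint_right.1 hdisj h1, h2, h3]
    omega
  have hTj : insert j T ∈ (P.erase i).powersetCard m := by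
    refine mem_powersetCard.2 ⟨insert_subset (mem_erase.2 ⟨hij.symm, hj⟩)
      (hT.trans (erase_subset _ _)), ?_⟩
    rw [card_insert_of_notMem hjT, hTm]
    omega
  have hTj' : insert j T ∈ ((C ∪ P).erase i).powersetCard m :=
    powersetCard_mono (erase_subset_erase _ subset_union_right) hTj
  have hTq : insert q T ∈ ((C ∪ P).erase i).powersetCard m := by
    refine mem_powersetCard.2 ⟨insert_subset (mem_erase.2 ⟨fun h => hiC (h ▸ hq),
      mem_union_left _ hq⟩) (hT.trans ((erase_subset _ _).trans
        (erase_subset_erase _ subset_union_right))), ?_⟩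
    rw [card_insert_of_notMem hqT, hTm]
    omega
  have hmj := hmarg _ hTj' _ hTj inter_subset_left
  have hmq := hmarg _ hTq _ hTj (by
    intro x hx
    simp only [mem_inter, mem_insert, mem_erase] at hx ⊢
    rcases hx with ⟨rfl | hx, hx'⟩
    · exact absurd hx'.2 (disjoint_left.1 hdisj hq)
    · exact Or.inr hx)
  rw [before_insert_eq_singleton hrji hrT] at hmj hmq
  rw [before_insert_eq_singleton (hlt q hq i hi) hrT] at hmq
  have hiCj : i ∉ C ∪ {j} := by simp [hiC, hij]
  have hqi : q ≠ i := fun h => hiC (h ▸ hq)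
  have hqj : q ≠ j := fun h => hjC (h ▸ hq)
  obtain ⟨s, hs, -⟩ := exists_residual hK hiCj
  obtain ⟨rj, hrj, -⟩ := exists_residual hK (i := i) (A := {j}) (by simpa using hij)
  obtain ⟨rq, hrq, -⟩ := exists_residual hK (i := i) (A := {q}) (by simpa using hqi.symm)
  have hj_eq := hrj.eq_of_marginal_eq hK subset_union_right hiCj hs hmj
  have hq_eq := hrq.eq_of_marginal_eq hK
    ((singleton_subset_iff.2 hq).trans subset_union_left) hiCj hs hmq
  have hsingle : s = Pi.single i 1 := by
    ext x
    by_cases hxi : x = i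
    · rw [hxi, hs.apply_self, Pi.single_eq_same]
    · rw [Pi.single_eq_of_ne hxi]
      by_cases hxj : x = j
      · rw [← hq_eq]
        exact hrq.apply_eq_zero x (by simp [hxj, hqj.symm, hij.symm])
      · rw [← hj_eq]
        exact hrj.apply_eq_zero x (by simp [hxi, hxj])
  intro a ha
  have := hs.mulVec_eq_zero a ha
  rw [hsingle] at this
  simpa using this

open Finset in
theorem conditional_hadamard_eq_iff (hK : K.PosDef) {C P : Finset (Fin n)}
    (hdisj : Disjoint C P) (hP : P.Nonempty) :
    logMinor K C + (1 / ((#P - 1).choose 0 : ℝ)) *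
        ∑ S ∈ P.powersetCard (0 + 1), (logMinor K (C ∪ S) - logMinor K C) =
      (1 / ((#(C ∪ P) - 1).choose 0 : ℝ)) * ∑ S ∈ (C ∪ P).powersetCard (0 + 1), logMinor K S ↔
    (∀ i ∈ P, ∀ a ∈ C, K i a = 0) ∧ ∀ i ∈ C, ∀ j ∈ C, i ≠ j → K i j = 0 := by
  have hsymm : ∀ i j, K i j = K j i := fun i j => by rw [← hK.isHermitian.apply]; simp
  constructor
  · intro h
    -- `i₀` only fills the arguments of `rankAfter`: any order placing `C` before `P` works here.
    obtain ⟨i₀, -⟩ := id hP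
    have h' := ((submodular_logMinor hK).conditional_han_le logMinor_empty
      (rankAfter_injective C i₀ i₀)
      (fun x hx y hy => rankAfter_lt i₀ i₀ hx (disjoint_right.1 hdisj hy))
      hP.card_pos).2 h
    refine ⟨fun i hi a ha => ?_, apply_eq_zero_of_before hK (rankAfter_injective C i₀ i₀) h'.1⟩
    have h0 := h'.2 i hi ∅ (by simp) ∅ (by simp) (by simp)
    rw [hsymm]
    refine apply_eq_zero_of_marginal_eq hK (disjoint_right.1 hdisj hi) ?_ a ha
    simpa [before] using h0.symm
  · rintro ⟨hPC, hCC⟩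
    refine conditional_han_eq_of_sum hdisj (by simpa using hP.card_pos)
      (fun i => Real.log (K i i)) ?_ ?_ ?_
    · exact logMinor_of_uncorrelated hK C fun i hi a ha hai => hCC a ha i hi hai
    · intro S hS
      obtain ⟨hSP, hS1⟩ := mem_powersetCard.1 hS
      obtain ⟨i, rfl⟩ := card_eq_one.1 hS1
      have hi := singleton_subset_iff.1 hSP
      refine logMinor_union_of_uncorrelated hK C {i} (disjoint_of_subset_right hSP hdisj) ?_
      intro x hx a ha hax
      rw [mem_singleton] at hx
      subst hx
      rw [mem_union, mem_singleton, or_iff_left hax] at ha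
      rw [hsymm, hPC x hi a ha]
    · intro S hS
      obtain ⟨i, rfl⟩ := card_eq_one.1 (mem_powersetCard.1 hS).2
      refine logMinor_of_uncorrelated hK {i} fun x hx a ha hax => ?_
      rw [mem_singleton] at hx ha
      exact absurd (ha.trans hx.symm) hax

open Finset in
theorem conditional_szasz_eq_iff (hK : K.PosDef) {P : Finset (Fin n)}
    {m : ℕ} (hm1 : 1 ≤ m) (hm : m + 1 ≤ #P) (hC : Pᶜ.Nonempty) :
    logMinor K Pᶜ + (1 / ((#P - 1).choose m : ℝ)) *
        ∑ S ∈ P.powersetCard (m + 1), (logMinor K (Pᶜ ∪ S) - logMinor K Pᶜ) =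
      (1 / ((#(Pᶜ ∪ P) - 1).choose m : ℝ)) * ∑ S ∈ (Pᶜ ∪ P).powersetCard (m + 1), logMinor K S ↔
    K.IsDiag := by
  have hdisj : Disjoint Pᶜ P := disjoint_compl_left
  have hsymm : ∀ i j, K i j = K j i := fun i j => by rw [← hK.isHermitian.apply]; simp
  constructor
  · intro h
    obtain ⟨i₀, -⟩ := id hC
    have hCC := apply_eq_zero_of_before hK (rankAfter_injective Pᶜ i₀ i₀)
      (((submodular_logMinor hK).conditional_han_le logMinor_empty
        (rankAfter_injective Pᶜ i₀ i₀)
        (fun x hx y hy => rankAfter_lt i₀ i₀ hx (disjoint_right.1 hdisj hy)) hm).2 h).1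
    have hP : ∀ i ∈ P, ∀ a, a ≠ i → K a i = 0 := by
      intro i hi a hai
      by_cases haP : a ∈ P
      · exact uncorrelated_of_conditional_han_eq hK hdisj hm1 hm hC h hi haP hai.symm a
          (by simp)
      · obtain ⟨j, hj, hji⟩ := exists_mem_ne (by omega : 1 < #P) i
        exact uncorrelated_of_conditional_han_eq hK hdisj hm1 hm hC h hi hj hji.symm a
          (by simp [haP])
    intro a i hai
    by_cases hi : i ∈ P
    · exact hP i hi a hai
    · by_cases ha : a ∈ P
      · rw [hsymm, hP a ha i hai.symm]
      · exact hCC a (mem_compl.2 ha) i (mem_compl.2 hi) hai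
  · intro h
    exact conditional_han_eq_of_sum hdisj hm (fun i => Real.log (K i i))
      (logMinor_of_uncorrelated hK _ fun i _ a _ hai => h hai)
      (fun S hS => logMinor_union_of_uncorrelated hK _ S
        (disjoint_of_subset_right (mem_powersetCard.1 hS).1 hdisj) fun i _ a _ hai => h hai)
      (fun S _ => logMinor_of_uncorrelated hK S fun i _ a _ hai => h hai)

/-! ### Passage from logarithms to determinants -/

theorem card_firstIdx {p : ℕ} (hp : p ≤ n) : (firstIdx n p).card = p := by
  have : firstIdx n p = Finset.univ.map (Fin.castLEEmb hp) := by
    ext x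
    simp only [firstIdx, Finset.mem_filter, Finset.mem_univ, true_and, Finset.mem_map]
    exact ⟨fun h => ⟨⟨x, h⟩, rfl⟩, fun ⟨y, hy⟩ => hy ▸ y.2⟩
  rw [this, Finset.card_map, Finset.card_univ, Fintype.card_fin]

theorem prod_rpow_eq_exp {ι : Type*} (s : Finset ι) (f g : ι → ℝ)
    (h : ∀ i ∈ s, f i = Real.exp (g i)) (c : ℝ) :
    (∏ i ∈ s, f i) ^ c = Real.exp (c * ∑ i ∈ s, g i) := by
  rw [Finset.prod_congr rfl h, ← Real.exp_sum, ← Real.exp_mul, mul_comm]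

theorem szaszBound_eq_exp (hK : K.PosDef) (m : ℕ) :
    szaszBound K (m + 1) = Real.exp ((1 / ((n - 1).choose m : ℝ)) *
      ∑ S ∈ (Finset.univ : Finset (Fin n)).powersetCard (m + 1), logMinor K S) := by
  rw [szaszBound, prod_rpow_eq_exp _ _ (logMinor K) fun S _ => (exp_logMinor hK S).symm,
    Nat.add_sub_cancel]

theorem condSzaszBound_eq_exp (hK : K.PosDef) (p m : ℕ) :
    condSzaszBound K p (m + 1) =
      Real.exp (logMinor K (firstIdx n p)ᶜ + (1 / ((p - 1).choose m : ℝ)) *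
        ∑ S ∈ (firstIdx n p).powersetCard (m + 1),
          (logMinor K ((firstIdx n p)ᶜ ∪ S) - logMinor K (firstIdx n p)ᶜ)) := by
  rw [condSzaszBound, prod_rpow_eq_exp _ _
    (fun S => logMinor K ((firstIdx n p)ᶜ ∪ S) - logMinor K (firstIdx n p)ᶜ)
    (fun S _ => by rw [Real.exp_sub, exp_logMinor hK, exp_logMinor hK, Finset.union_comm]),
    Real.exp_add, exp_logMinor hK, Nat.add_sub_cancel]

end

theorem theorem4 (n : ℕ) (K : Matrix (Fin n) (Fin n) ℝ) (hK : K.PosDef)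
    (k p : ℕ) (hk : 1 ≤ k) (hkp : k ≤ p) (hpn : p ≤ n) :
    K.det ≤ condSzaszBound K p k ∧
    condSzaszBound K p k ≤ szaszBound K k ∧
    (k < p → (K.det = condSzaszBound K p k ↔ (schurCompl K (firstIdx n p)).IsDiag)) ∧
    (k = 1 → p < n →
      (condSzaszBound K p k = szaszBound K k ↔
        subMat K (firstIdx n p) (firstIdx n p)ᶜ = 0 ∧
        (subMat K (firstIdx n p)ᶜ (firstIdx n p)ᶜ).IsDiag)) ∧
    (2 ≤ k → p < n → (condSzaszBound K p k = szaszBound K k ↔ K.IsDiag)) ∧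
    (p = n → condSzaszBound K p k = szaszBound K k) ∧
    (k = 1 →
      condSzaszBound K p k =
        minorDet K (firstIdx n p)ᶜ *
          ∏ i ∈ firstIdx n p,
            minorDet K ({i} ∪ (firstIdx n p)ᶜ) / minorDet K (firstIdx n p)ᶜ) := by
  obtain ⟨m, rfl⟩ : ∃ m, k = m + 1 := ⟨k - 1, by omega⟩
  have hg := submodular_logMinor hK
  have hcard := card_firstIdx hpn
  set P := firstIdx n p with hP
  have hdisj : Disjoint Pᶜ P := disjoint_compl_left
  have huniv : Pᶜ ∪ P = Finset.univ := by rw [Finset.union_comm, Finset.union_compl]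
  have hm : m + 1 ≤ P.card := by omega
  have hPne : P.Nonempty := Finset.card_pos.1 (by omega)
  obtain ⟨i₀, hi₀⟩ := id hPne
  have hdet : K.det = Real.exp (logMinor K (Pᶜ ∪ P)) := by
    rw [exp_logMinor hK, huniv, minorDet_univ]
  have hcond := condSzaszBound_eq_exp hK p m
  have hszasz := szaszBound_eq_exp hK m
  have hN : (n - 1).choose m = ((Pᶜ ∪ P).card - 1).choose m := by
    rw [huniv, Finset.card_univ, Fintype.card_fin]
  rw [← hP, show (p - 1).choose m = (P.card - 1).choose m by rw [hcard]] at hcond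
  rw [← huniv, hN] at hszasz
  have hCne : p < n → Pᶜ.Nonempty := fun h => by
    rw [← Finset.card_pos, Finset.card_compl, Fintype.card_fin]
    omega
  refine ⟨?_, ?_, fun hlt => ?_, fun h1 _ => ?_, fun h2 hlt => ?_, fun hp => ?_, fun h1 => ?_⟩
  · rw [hdet, hcond, Real.exp_le_exp]
    exact (hg.han Fin.val_injective hdisj hm).1
  · rw [hcond, hszasz, Real.exp_le_exp]
    exact (hg.conditional_han_le logMinor_empty (rankAfter_injective Pᶜ i₀ i₀)
      (fun x hx y hy => rankAfter_lt i₀ i₀ hx (Finset.disjoint_right.1 hdisj hy)) hm).1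
  · rw [hdet, hcond, Real.exp_eq_exp]
    exact ⟨schurCompl_isDiag_of_han_eq hK (by omega), han_eq_of_schurCompl_isDiag hK hm⟩
  · obtain rfl : m = 0 := by omega
    rw [hcond, hszasz, Real.exp_eq_exp, conditional_hadamard_eq_iff hK hdisj hPne]
    refine and_congr ⟨fun h => ?_, fun h i hi a ha => ?_⟩ ⟨fun h => ?_, fun h i hi j hj hij => ?_⟩
    · ext i a
      exact h i i.2 a a.2
    · exact congrFun (congrFun h ⟨i, hi⟩) ⟨a, ha⟩
    · exact fun i j hij => h i i.2 j j.2 fun h => hij (Subtype.ext h)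
    · exact h (i := ⟨i, hi⟩) (j := ⟨j, hj⟩) fun h => hij (congrArg Subtype.val h)
  · rw [hcond, hszasz, Real.exp_eq_exp]
    exact conditional_szasz_eq_iff hK (by omega) hm (hCne hlt)
  -- Here `Pᶜ` is empty, so the conditioning disappears.
  · have hPu : P = Finset.univ := Finset.eq_univ_of_card P (by simp [hcard, hp])
    rw [hcond, hszasz]
    simp [hPu, logMinor_empty]
  · obtain rfl : m = 0 := by omega
    rw [condSzaszBound, ← hP]
    simp [Finset.powersetCard_one]
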